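/- Let $\mathbb{V}_n=\mathbb{F}_2^n$. Every Boolean function $f:\mathbb{V}_n\to\mathbb{F}_2$ has a unique algebraic normal form (ANF) $f(x_0,\dots,x_{n-1})=\sum_{S\subseteq\{0,\dots,n-1\}}c_S\prod_{i\in S}x_i$ with $c_S\in\mathbb{F}_2$. The degree of $f$ is the largest $|S|$ with $c_S\neq0$, and $f$ is homogeneous if exactly one value $|S|$ occurs among the sets $S$ with $c_S\ne 0$. The function $f$ is rotation symmetric if its ANF is invariant under all powers of the cyclic shift $x_i\mapsto x_{i+1}$ of the variables (indices modulo $n$). It is bent if $\sum_{x\in\mathbb{V}_n}(-1)^{f(x)+w\cdot x}\in\{2^{n/2},-2^{n/2}\}$ for every $w\in\mathbb{V}_n$. **Theorem.** Let $p$ be an odd prime and $n=2p$, and let $f:\mathbb{V}_n\to\mathbb{F}_2$ be a homogeneous rotation symmetric bent function of degree $d\ge 3$. Then $d\le (p+3)/2$. -/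

import Mathlib

namespace RotBent

/-- The `n`-dimensional vector space over the field with two elements. -/
abbrev V (n : ℕ) : Type := Fin n → ZMod 2

/-- Boolean functions in `n` variables. -/
abbrev BoolFun (n : ℕ) : Type := V n → ZMod 2

/-- The vector of `V n` whose coordinates equal to `1` are exactly those in `T`. -/
def indicatorVec {n : ℕ} (T : Finset (Fin n)) : V n := fun i => if i ∈ T then 1 else 0

/-- The coefficient of the monomial `∏ i ∈ S, x i` in the algebraic normal form (ANF) of `f`.
The theorems `anf_expansion` and `anf_unique` below show that these are the coefficients of the
one and only expression of `f` as a polynomial with exponents in `{0, 1}`. -/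
def anfCoeff {n : ℕ} (f : BoolFun n) (S : Finset (Fin n)) : ZMod 2 :=
  ∑ T ∈ S.powerset, f (indicatorVec T)

theorem sum_powerset_powerset {n : ℕ} (g : Finset (Fin n) → ZMod 2) (X : Finset (Fin n)) :
    ∑ S ∈ X.powerset, ∑ T ∈ S.powerset, g T = g X := by
  have h1 : ∑ S ∈ X.powerset, ∑ T ∈ S.powerset, g T
      = ∑ T ∈ X.powerset, ∑ S ∈ Finset.Icc T X, g T := by
    apply Finset.sum_comm'
    intro S T
    simp only [Finset.mem_powerset, Finset.mem_Icc]
    exact ⟨fun h => ⟨⟨h.2, h.1⟩, h.2.trans h.1⟩, fun h => ⟨h.1.2, h.1.1⟩⟩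
  rw [h1, Finset.sum_eq_single X]
  · simp
  · intro T hT hne
    have hsub : T ⊆ X := Finset.mem_powerset.1 hT
    have hlt : T.card < X.card := Finset.card_lt_card (hsub.ssubset_of_ne hne)
    rw [Finset.sum_const, Finset.card_Icc_finset hsub, nsmul_eq_mul, Nat.cast_pow]
    have h2 : ((2 : ℕ) : ZMod 2) = 0 := by decide
    rw [h2, zero_pow (by omega), zero_mul]
  · intro h
    exact absurd (Finset.mem_powerset_self X) h

theorem sum_monomial {n : ℕ} (c : Finset (Fin n) → ZMod 2) (X : Finset (Fin n)) :
    ∑ S, c S * ∏ i ∈ S, indicatorVec X i = ∑ S ∈ X.powerset, c S := by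
  have h : ∀ S : Finset (Fin n),
      c S * ∏ i ∈ S, indicatorVec X i = if S ∈ X.powerset then c S else 0 := by
    intro S
    by_cases hS : S ⊆ X
    · have : ∏ i ∈ S, indicatorVec X i = 1 :=
        Finset.prod_eq_one fun i hi => by simp [indicatorVec, hS hi]
      simp [this, hS]
    · obtain ⟨i, hi, hiX⟩ := Finset.not_subset.1 hS
      have : ∏ i ∈ S, indicatorVec X i = 0 :=
        Finset.prod_eq_zero hi (by simp [indicatorVec, hiX])
      simp [this, hS]
  simp only [h]
  rw [← Finset.sum_filter]
  congr 1
  ext S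
  simp

theorem exists_indicatorVec {n : ℕ} (x : V n) : ∃ X, x = indicatorVec X := by
  refine ⟨Finset.univ.filter fun i => x i = 1, funext fun i => ?_⟩
  have h : ∀ a : ZMod 2, a = if a = 1 then 1 else 0 := by decide
  simpa [indicatorVec] using h (x i)

/-- Every Boolean function is given by its algebraic normal form. -/
theorem anf_expansion {n : ℕ} (f : BoolFun n) (x : V n) :
    f x = ∑ S : Finset (Fin n), anfCoeff f S * ∏ i ∈ S, x i := by
  obtain ⟨X, rfl⟩ := exists_indicatorVec x
  rw [sum_monomial]
  exact (sum_powerset_powerset (fun T => f (indicatorVec T)) X).symm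

/-- The algebraic normal form is unique. -/
theorem anf_unique {n : ℕ} (f : BoolFun n) (c : Finset (Fin n) → ZMod 2)
    (h : ∀ x : V n, f x = ∑ S : Finset (Fin n), c S * ∏ i ∈ S, x i) : c = anfCoeff f := by
  funext S
  simp only [anfCoeff, h, sum_monomial]
  exact (sum_powerset_powerset c S).symm

/-- The set of the degrees of the monomials occurring in the ANF of `f`. -/
def degreeSet {n : ℕ} (f : BoolFun n) : Finset ℕ :=
  (Finset.univ.filter fun S : Finset (Fin n) => anfCoeff f S ≠ 0).image Finset.card

/-- The algebraic degree: the largest degree of a monomial occurring in the ANF of `f`. -/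
def degree {n : ℕ} (f : BoolFun n) : ℕ := (degreeSet f).sup id

/-- `f` is homogeneous: all monomials occurring in its ANF have one and the same degree. -/
def IsHomogeneous {n : ℕ} (f : BoolFun n) : Prop := (degreeSet f).card = 1

/-- `f` is rotation symmetric: its ANF is invariant under every power of the cyclic permutation
`x_i ↦ x_(i+1)` of the variables (indices modulo `n`). -/
def IsRotationSymmetric {n : ℕ} (f : BoolFun n) : Prop :=
  ∀ (k : ℕ) (S : Finset (Fin n)),
    anfCoeff f (S.map ((finRotate n) ^ k).toEmbedding) = anfCoeff f S

/-- The sign function `(-1) ^ f(x)`. -/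
def signFun {n : ℕ} (f : BoolFun n) (x : V n) : ℝ := (-1) ^ (f x).val

/-- The Walsh transform of a real-valued function on `V n`. -/
noncomputable def walsh {n : ℕ} (g : V n → ℝ) (w : V n) : ℝ :=
  ∑ x : V n, g x * (-1) ^ (dotProduct w x).val

/-- `f` is bent: all Walsh coefficients of its sign function are `± 2 ^ (n / 2)`. -/
def IsBent {n : ℕ} (f : BoolFun n) : Prop :=
  ∀ w : V n, walsh (signFun f) w = (2 : ℝ) ^ ((n : ℝ) / 2) ∨
    walsh (signFun f) w = -(2 : ℝ) ^ ((n : ℝ) / 2)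

end RotBent

/-! Since every monomial of `f` has degree `d`, `f` vanishes on all vectors of weight below `d`, so
its sign function `g` is `1` on a Hamming ball, while bentness keeps all Walsh coefficients of `g`
at most `2 ^ p` in size. These facts conflict once `2 * d ≥ p + 5` (`not_eq_one_on_ball`). Restrict
to a `k`-dimensional coordinate subspace, where character sums of `g` are still at most `2 ^ p`
(`abs_sum_powerset_character_le`). Take a polynomial `φ` in `X = k - 2 * weight` that is nonpositive
outside the ball. As `g ≤ 1`, with equality on the ball, `∑ φ ≤ ∑ φ * g`; the right side is at most
`2 ^ p` times a bound for the `ℓ¹` norm of the Fourier coefficients of `φ`. A linear `φ` gives a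
contradiction for `p < 11`, and `(X - e) * (X + c) ^ 2` does for larger `p`. -/

open Finset

namespace RotBent

/-! ### Characters in terms of supports -/

/-- The sign of the `i`-th coordinate of the vector with support `T`. -/
def coordSign {n : ℕ} (i : Fin n) (T : Finset (Fin n)) : ℝ := if i ∈ T then -1 else 1

/-- The character of `V n` belonging to `W`, on the vector with support `T`. -/
def character {n : ℕ} (W T : Finset (Fin n)) : ℝ := ∏ i ∈ W, coordSign i T

/-- The sum of the coordinate signs over `S`. -/
def signSum {n : ℕ} (S T : Finset (Fin n)) : ℝ := ∑ i ∈ S, coordSign i T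

lemma coordSign_mul_self {n : ℕ} (i : Fin n) (T : Finset (Fin n)) :
    coordSign i T * coordSign i T = 1 := by
  unfold coordSign; split_ifs <;> norm_num

lemma exists_coordSign_mul_character {n : ℕ} (i : Fin n) (W : Finset (Fin n)) :
    ∃ W', ∀ T, coordSign i T * character W T = character W' T := by
  by_cases h : i ∈ W
  · refine ⟨W.erase i, fun T => ?_⟩
    unfold character
    rw [← Finset.mul_prod_erase W _ h, ← mul_assoc, coordSign_mul_self, one_mul]
  · exact ⟨insert i W, fun T => by unfold character; rw [Finset.prod_insert h]⟩

lemma signSum_of_subset {n : ℕ} {S T : Finset (Fin n)} (h : T ⊆ S) :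
    signSum S T = (S.card : ℝ) - 2 * T.card := by
  have h1 : ∀ i, coordSign i T = 1 - 2 * (if i ∈ T then (1 : ℝ) else 0) := by
    intro i; unfold coordSign; split_ifs <;> norm_num
  simp only [signSum, h1, Finset.sum_sub_distrib, ← Finset.mul_sum]
  simp [Finset.inter_eq_right.2 h]

lemma sum_character_powerset {n : ℕ} (S T : Finset (Fin n)) :
    ∑ W ∈ Sᶜ.powerset, character W T = if T ⊆ S then 2 ^ Sᶜ.card else 0 := by
  unfold character
  rw [← Finset.prod_one_add]
  split_ifs with h
  · rw [← Finset.prod_const]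
    refine Finset.prod_congr rfl fun i hi => ?_
    have : i ∉ T := fun hT => (Finset.mem_compl.1 hi) (h hT)
    simp [coordSign, this]; norm_num
  · obtain ⟨i, hi, hiS⟩ := Finset.not_subset.1 h
    exact Finset.prod_eq_zero (Finset.mem_compl.2 hiS) (by simp [coordSign, hi])

lemma character_union {n : ℕ} {A B : Finset (Fin n)} (h : Disjoint A B) (T : Finset (Fin n)) :
    character (A ∪ B) T = character A T * character B T := Finset.prod_union h

lemma indicatorVec_injective {n : ℕ} : Function.Injective (indicatorVec (n := n)) := by
  intro A B h
  ext i
  have := congrFun h i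
  unfold indicatorVec at this
  by_cases hA : i ∈ A <;> by_cases hB : i ∈ B <;> simp_all

lemma neg_one_pow_val_add (a b : ZMod 2) :
    (-1 : ℝ) ^ (a + b).val = (-1) ^ a.val * (-1) ^ b.val := by
  have h : ∀ a b : ZMod 2, ((a + b).val + a.val + b.val) % 2 = 0 := by decide
  have h2 : (-1 : ℝ) ^ ((a + b).val + a.val + b.val) = 1 :=
    (Nat.even_iff.2 (h a b)).neg_one_pow
  rw [pow_add, pow_add] at h2
  rcases neg_one_pow_eq_or ℝ a.val with ha | ha <;>
    rcases neg_one_pow_eq_or ℝ b.val with hb | hb <;> rw [ha, hb] at h2 ⊢ <;> linarith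

lemma neg_one_pow_val_sum {ι : Type*} (s : Finset ι) (g : ι → ZMod 2) :
    (-1 : ℝ) ^ (∑ i ∈ s, g i).val = ∏ i ∈ s, (-1) ^ (g i).val := by
  classical
  induction s using Finset.induction_on with
  | empty => simp
  | insert a s ha ih => rw [Finset.sum_insert ha, Finset.prod_insert ha, neg_one_pow_val_add, ih]

lemma neg_one_pow_dotProduct {n : ℕ} (W T : Finset (Fin n)) :
    (-1 : ℝ) ^ (dotProduct (indicatorVec W) (indicatorVec T)).val = character W T := by
  unfold dotProduct character
  rw [neg_one_pow_val_sum, ← Finset.prod_subset (Finset.subset_univ W)]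
  · refine Finset.prod_congr rfl fun i hi => ?_
    by_cases h : i ∈ T <;> simp [indicatorVec, coordSign, hi, h, ZMod.val_one]
  · intro i _ hi
    simp [indicatorVec, hi]

lemma walsh_indicatorVec {n : ℕ} (g : V n → ℝ) (W : Finset (Fin n)) :
    walsh g (indicatorVec W) = ∑ T, g (indicatorVec T) * character W T := by
  unfold walsh
  have hbij : Function.Bijective (indicatorVec (n := n)) :=
    ⟨indicatorVec_injective, fun x => (exists_indicatorVec x).imp fun _ h => h.symm⟩
  rw [← hbij.sum_comp]
  exact Finset.sum_congr rfl fun T _ => by rw [neg_one_pow_dotProduct]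

/-! ### Flat spectrum and sums over coordinate subspaces -/

/-- A uniform bound on the Walsh transform bounds all signed sums over coordinate subspaces. -/
lemma abs_sum_powerset_character_le {n : ℕ} (g : V n → ℝ) {C : ℝ}
    (hC : ∀ w, |walsh g w| ≤ C) (S W : Finset (Fin n)) :
    |∑ T ∈ S.powerset, character W T * g (indicatorVec T)| ≤ C := by
  have hinter : ∀ T ∈ S.powerset, character W T = character (W ∩ S) T := by
    intro T hT
    unfold character
    refine (Finset.prod_subset Finset.inter_subset_left fun i hi hn => ?_).symm
    have : i ∉ T := fun h =>
      hn (Finset.mem_inter.2 ⟨hi, Finset.mem_powerset.1 hT h⟩)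
    simp [coordSign, this]
  -- Poisson summation: summing the Walsh transform over all `U ⊆ Sᶜ` kills every `T` not inside
  -- `S`.
  have key : ∑ U ∈ Sᶜ.powerset, walsh g (indicatorVec (W ∩ S ∪ U))
      = 2 ^ Sᶜ.card * ∑ T ∈ S.powerset, character W T * g (indicatorVec T) := by
    have h1 : ∀ U ∈ Sᶜ.powerset, walsh g (indicatorVec (W ∩ S ∪ U))
        = ∑ T, g (indicatorVec T) * character (W ∩ S) T * character U T := by
      intro U hU
      rw [walsh_indicatorVec]
      refine Finset.sum_congr rfl fun T _ => ?_
      rw [character_union, mul_assoc]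
      exact Finset.disjoint_of_subset_left Finset.inter_subset_right
        (Finset.disjoint_of_subset_right (Finset.mem_powerset.1 hU) disjoint_compl_right)
    rw [Finset.sum_congr rfl h1, Finset.sum_comm]
    simp only [← Finset.mul_sum, sum_character_powerset, mul_ite, mul_zero]
    rw [← Finset.sum_filter, Finset.mul_sum]
    refine Finset.sum_congr (by ext T; simp) fun T hT => ?_
    rw [hinter T hT]; ring
  have hle : |∑ U ∈ Sᶜ.powerset, walsh g (indicatorVec (W ∩ S ∪ U))| ≤ 2 ^ Sᶜ.card * C := by
    refine (Finset.abs_sum_le_sum_abs _ _).trans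
      ((Finset.sum_le_sum fun U _ => hC _).trans_eq ?_)
    rw [Finset.sum_const, Finset.card_powerset, nsmul_eq_mul]; push_cast; ring
  rw [key, abs_mul, abs_of_pos (by positivity : (0 : ℝ) < 2 ^ Sᶜ.card)] at hle
  exact le_of_mul_le_mul_left hle (by positivity)

/-- Multiplying a test function by `signSum S + a` raises the bound on its character sums by the
factor `|S| + |a|`. -/
lemma abs_sum_signSum_add_mul_le {n : ℕ} {S : Finset (Fin n)} {s φ : Finset (Fin n) → ℝ} {C : ℝ}
    (h : ∀ W, |∑ T ∈ S.powerset, φ T * (character W T * s T)| ≤ C) (a : ℝ) (W : Finset (Fin n)) :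
    |∑ T ∈ S.powerset, (signSum S T + a) * φ T * (character W T * s T)|
      ≤ (S.card + |a|) * C := by
  have h1 : ∑ T ∈ S.powerset, (signSum S T + a) * φ T * (character W T * s T)
      = ∑ i ∈ S, ∑ T ∈ S.powerset, φ T * (coordSign i T * character W T * s T)
        + a * ∑ T ∈ S.powerset, φ T * (character W T * s T) := by
    rw [Finset.sum_comm, Finset.mul_sum, ← Finset.sum_add_distrib]
    refine Finset.sum_congr rfl fun T _ => ?_
    rw [signSum, add_mul, add_mul, Finset.sum_mul, Finset.sum_mul]
    congr 1
    · exact Finset.sum_congr rfl fun i _ => by ring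
    · ring
  rw [h1, add_mul]
  refine (abs_add_le _ _).trans (add_le_add ?_ ?_)
  · refine (Finset.abs_sum_le_sum_abs _ _).trans
      ((Finset.sum_le_sum (g := fun _ => C) fun i _ => ?_).trans_eq (by simp))
    -- A sign times a character is again a character, so each of the `|S|` terms obeys the old
    -- bound.
    obtain ⟨W', hW'⟩ := exists_coordSign_mul_character i W
    simpa only [hW'] using h W'
  · rw [abs_mul]
    exact mul_le_mul_of_nonneg_left (h W) (abs_nonneg a)

/-! ### Means of the test polynomials -/

lemma sum_powerset_signSum {n : ℕ} (S : Finset (Fin n)) (F : ℝ → ℝ) :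
    ∑ T ∈ S.powerset, F (signSum S T) = ∑ T ∈ S.powerset, F ((S.card : ℝ) - 2 * T.card) :=
  Finset.sum_congr rfl fun _ hT => by rw [signSum_of_subset (Finset.mem_powerset.1 hT)]

lemma sum_powerset_insert_sub_two_mul_card {α : Type*} [DecidableEq α] {i : α} {S : Finset α}
    (hi : i ∉ S) (F : ℝ → ℝ) :
    ∑ T ∈ (insert i S).powerset, F (((insert i S).card : ℝ) - 2 * T.card)
      = ∑ T ∈ S.powerset, (F ((S.card : ℝ) - 2 * T.card + 1)
          + F ((S.card : ℝ) - 2 * T.card - 1)) := by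
  rw [Finset.sum_powerset_insert hi, ← Finset.sum_add_distrib]
  refine Finset.sum_congr rfl fun T hT => ?_
  have hT' : i ∉ T := fun h => hi (Finset.mem_powerset.1 hT h)
  rw [Finset.card_insert_of_notMem hi, Finset.card_insert_of_notMem hT']
  push_cast
  congr 2 <;> ring

/-- The first three moments of the sum of `|S|` independent random signs. -/
lemma sum_powerset_moments {α : Type*} [DecidableEq α] (S : Finset α) :
    ∑ T ∈ S.powerset, ((S.card : ℝ) - 2 * T.card) = 0 ∧
    ∑ T ∈ S.powerset, ((S.card : ℝ) - 2 * T.card) ^ 2 = (2 : ℝ) ^ S.card * S.card ∧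
    ∑ T ∈ S.powerset, ((S.card : ℝ) - 2 * T.card) ^ 3 = 0 := by
  induction S using Finset.induction_on with
  | empty => simp
  | insert i S hi ih =>
    obtain ⟨h1, h2, h3⟩ := ih
    have h0 : ∑ T ∈ S.powerset, (1 : ℝ) = 2 ^ S.card := by simp
    refine ⟨?_, ?_, ?_⟩
    · rw [sum_powerset_insert_sub_two_mul_card hi (fun x => x)]
      calc _ = 2 * ∑ T ∈ S.powerset, ((S.card : ℝ) - 2 * T.card) := by
            rw [Finset.mul_sum]; exact Finset.sum_congr rfl fun _ _ => by ring
        _ = 0 := by rw [h1, mul_zero]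
    · rw [sum_powerset_insert_sub_two_mul_card hi (fun x => x ^ 2)]
      calc _ = 2 * ∑ T ∈ S.powerset, ((S.card : ℝ) - 2 * T.card) ^ 2
              + 2 * ∑ T ∈ S.powerset, (1 : ℝ) := by
            rw [Finset.mul_sum, Finset.mul_sum, ← Finset.sum_add_distrib]
            exact Finset.sum_congr rfl fun _ _ => by ring
        _ = _ := by
            rw [h2, h0, Finset.card_insert_of_notMem hi]; push_cast; ring
    · rw [sum_powerset_insert_sub_two_mul_card hi (fun x => x ^ 3)]
      calc _ = 2 * ∑ T ∈ S.powerset, ((S.card : ℝ) - 2 * T.card) ^ 3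
              + 6 * ∑ T ∈ S.powerset, ((S.card : ℝ) - 2 * T.card) := by
            rw [Finset.mul_sum, Finset.mul_sum, ← Finset.sum_add_distrib]
            exact Finset.sum_congr rfl fun _ _ => by ring
        _ = 0 := by rw [h1, h3]; ring

lemma sum_powerset_cubic {α : Type*} [DecidableEq α] (S : Finset α) (e c : ℝ) :
    ∑ T ∈ S.powerset, (((S.card : ℝ) - 2 * T.card) + -e) * (((S.card : ℝ) - 2 * T.card) + c) ^ 2
      = 2 ^ S.card * ((2 * c - e) * S.card - e * c ^ 2) := by
  obtain ⟨h1, h2, h3⟩ := sum_powerset_moments S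
  have h0 : ∑ T ∈ S.powerset, (1 : ℝ) = 2 ^ S.card := by simp
  calc _ = ∑ T ∈ S.powerset, ((S.card : ℝ) - 2 * T.card) ^ 3
        + (2 * c - e) * ∑ T ∈ S.powerset, ((S.card : ℝ) - 2 * T.card) ^ 2
        + (c ^ 2 - 2 * e * c) * ∑ T ∈ S.powerset, ((S.card : ℝ) - 2 * T.card)
        - e * c ^ 2 * ∑ T ∈ S.powerset, (1 : ℝ) := by
        simp only [Finset.mul_sum, ← Finset.sum_add_distrib, ← Finset.sum_sub_distrib]
        exact Finset.sum_congr rfl fun _ _ => by ring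
    _ = _ := by rw [h0, h1, h2, h3]; ring

lemma sum_powerset_linear {α : Type*} [DecidableEq α] (S : Finset α) (e : ℝ) :
    ∑ T ∈ S.powerset, (((S.card : ℝ) - 2 * T.card) + -e) = 2 ^ S.card * -e := by
  rw [Finset.sum_add_distrib, (sum_powerset_moments S).1]
  simp

/-! ### Testing against linear and cubic polynomials -/

/-- A test function which is nonpositive where `s` may differ from `1`. -/
lemma sum_le_sum_mul_of_nonpos {ι : Type*} (A : Finset ι) (φ s : ι → ℝ)
    (hs : ∀ i ∈ A, s i ≤ 1) (h : ∀ i ∈ A, s i = 1 ∨ φ i ≤ 0) :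
    ∑ i ∈ A, φ i ≤ ∑ i ∈ A, φ i * s i := by
  refine Finset.sum_le_sum fun i hi => ?_
  rcases h i hi with h1 | h1
  · rw [h1, mul_one]
  · nlinarith [hs i hi]

section Vanishing

variable {n D : ℕ} {g : V n → ℝ} {C : ℝ}

lemma linear_test (hC : ∀ w, |walsh g w| ≤ C) (hg : ∀ x, g x ≤ 1)
    (hD : ∀ T : Finset (Fin n), T.card < D → g (indicatorVec T) = 1)
    {k : ℕ} (hk : k ≤ n) {e : ℝ} (he : (k : ℝ) - 2 * D = e) :
    2 ^ k * -e ≤ (k + |e|) * C := by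
  obtain ⟨S, -, hS⟩ := Finset.exists_subset_card_eq
    (s := (Finset.univ : Finset (Fin n))) (n := k) (by simpa using hk)
  have h1 := abs_sum_signSum_add_mul_le (S := S) (φ := fun _ => 1)
    (s := fun T => g (indicatorVec T))
    (by simpa using abs_sum_powerset_character_le g hC S) (-e) ∅
  simp only [character, Finset.prod_empty, mul_one, one_mul, abs_neg, hS] at h1
  refine le_trans ?_ ((le_abs_self _).trans h1)
  rw [← hS, ← sum_powerset_linear, ← sum_powerset_signSum S (fun x => x + -e)]
  refine sum_le_sum_mul_of_nonpos _ _ _ (fun T _ => hg _) fun T hT => ?_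
  rcases lt_or_ge T.card D with h | h
  · exact Or.inl (hD T h)
  · right
    have h' : (D : ℝ) ≤ T.card := by exact_mod_cast h
    rw [signSum_of_subset (Finset.mem_powerset.1 hT), hS]
    linarith

/-- The square leaves the sign of `X - e` unchanged but can make the mean positive even for `e > 0`,
so subspaces of dimension `k > 2 * D` become usable. -/
lemma cubic_test (hC : ∀ w, |walsh g w| ≤ C) (hg : ∀ x, g x ≤ 1)
    (hD : ∀ T : Finset (Fin n), T.card < D → g (indicatorVec T) = 1)
    {k : ℕ} (hk : k ≤ n) {e : ℝ} (he : (k : ℝ) - 2 * D = e) (c : ℝ) :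
    2 ^ k * ((2 * c - e) * k - e * c ^ 2) ≤ (k + |e|) * ((k + |c|) * ((k + |c|) * C)) := by
  obtain ⟨S, -, hS⟩ := Finset.exists_subset_card_eq
    (s := (Finset.univ : Finset (Fin n))) (n := k) (by simpa using hk)
  have h0 : ∀ W, |∑ T ∈ S.powerset,
      (fun _ => (1 : ℝ)) T * (character W T * (fun T => g (indicatorVec T)) T)| ≤ C := by
    simpa using abs_sum_powerset_character_le g hC S
  have h1 := abs_sum_signSum_add_mul_le (abs_sum_signSum_add_mul_le
    (abs_sum_signSum_add_mul_le h0 c) c) (-e) ∅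
  simp only [character, Finset.prod_empty, mul_one, one_mul, abs_neg, hS] at h1
  refine le_trans ?_ ((le_abs_self _).trans h1)
  rw [← hS, ← sum_powerset_cubic, ← sum_powerset_signSum S (fun x => (x + -e) * (x + c) ^ 2)]
  simp only [sq]
  refine sum_le_sum_mul_of_nonpos _ _ _ (fun T _ => hg _) fun T hT => ?_
  rcases lt_or_ge T.card D with h | h
  · exact Or.inl (hD T h)
  · right
    have h' : (D : ℝ) ≤ T.card := by exact_mod_cast h
    refine mul_nonpos_of_nonpos_of_nonneg ?_ (mul_self_nonneg _)
    rw [signSum_of_subset (Finset.mem_powerset.1 hT), hS]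
    linarith

end Vanishing

/-! ### Choice of parameters and the contradiction -/

lemma pow_four_lt_two_pow_mul {t : ℕ} (ht : 10 ≤ t) : (2 * t + 3) ^ 4 < 2 ^ (t + 5) * t := by
  induction t, ht using Nat.le_induction with
  | base => norm_num
  | succ t ht ih =>
    have h1 : (2 * (t + 1) + 3) ^ 4 ≤ 2 * (2 * t + 3) ^ 4 := by
      -- With `t = 10 + u` the two polynomials in `u` compare coefficient by coefficient.
      obtain ⟨u, rfl⟩ := Nat.exists_eq_add_of_le ht
      ring_nf
      gcongr <;> norm_num
    calc _ ≤ _ := h1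
      _ < 2 * (2 ^ (t + 5) * t) := by omega
      _ = 2 ^ (t + 1 + 5) * t := by ring
      _ ≤ _ := Nat.mul_le_mul_left _ (by omega)

/-- For `m ≥ 11` the cubic test function can be chosen so that its mean exceeds the bound which
flatness of the Walsh spectrum imposes. -/
lemma exists_cubic_parameters {m : ℕ} (hm : 11 ≤ m) :
    ∃ e c : ℕ, e + 5 ≤ m ∧ (m + 5 + e + e) * (m + 5 + e + c) ^ 2 + 2 ^ (e + 5) * (e * c ^ 2 +
      e * (m + 5 + e)) < 2 ^ (e + 5) * (2 * c * (m + 5 + e)) := by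
  by_cases h1 : m ≤ 23
  · refine ⟨3, 7, by omega, ?_⟩
    interval_cases m <;> norm_num
  by_cases h2 : m ≤ 39
  · refine ⟨4, 8, by omega, ?_⟩
    interval_cases m <;> norm_num
  by_cases h3 : m ≤ 100
  · refine ⟨6, 9, by omega, ?_⟩
    interval_cases m <;> norm_num
  by_cases h4 : m ≤ 400
  · refine ⟨9, 16, by omega, ?_⟩
    interval_cases m <;> norm_num
  -- From here `t ≈ √m / 2`, `e = t`, `c = 2 * t`. As `4 * t ^ 2 ≤ k`, the negative terms cost at
  -- most half of `2 * c * k`; the other half, `2 * t * k`, beats the Fourier bound because `2 ^ (t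
  -- + 5)` outgrows `t ^ 3`.
  obtain ⟨t, ht1, ht2⟩ : ∃ t, 4 * t ^ 2 ≤ m ∧ m < 4 * (t + 1) ^ 2 := by
    refine ⟨Nat.sqrt (m / 4), ?_, ?_⟩
    · have := Nat.sqrt_le' (m / 4); omega
    · have := Nat.lt_succ_sqrt' (m / 4); simp only [Nat.succ_eq_add_one] at this; omega
  have ht : 10 ≤ t := by
    by_contra h
    have : t + 1 ≤ 10 := by omega
    have := Nat.pow_le_pow_left this 2
    omega
  have hpow := pow_four_lt_two_pow_mul ht
  refine ⟨t, 2 * t, by nlinarith, ?_⟩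
  obtain ⟨k, hk⟩ : ∃ k, k = m + 5 + t := ⟨_, rfl⟩
  rw [← hk]
  have hk1 : 4 * t ^ 2 ≤ k := by omega
  have hk2 : k + 2 * t ≤ (2 * t + 3) ^ 2 := by nlinarith
  have hk3 : k + t ≤ 2 * k := by omega
  have hkpos : 0 < k := by omega
  have h5 : (k + t) * (k + 2 * t) ^ 2 < 2 ^ (t + 5) * (2 * t * k) := by
    calc _ ≤ 2 * k * ((2 * t + 3) ^ 2) ^ 2 := by gcongr
      _ = 2 * k * (2 * t + 3) ^ 4 := by ring
      _ < 2 * k * (2 ^ (t + 5) * t) := by gcongr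
      _ = _ := by ring
  have h6 : t * (2 * t) ^ 2 + t * k + 2 * t * k ≤ 2 * (2 * t) * k := by nlinarith
  calc _ < 2 ^ (t + 5) * (2 * t * k) + 2 ^ (t + 5) * (t * (2 * t) ^ 2 + t * k) := by gcongr
    _ = 2 ^ (t + 5) * (t * (2 * t) ^ 2 + t * k + 2 * t * k) := by ring
    _ ≤ _ := Nat.mul_le_mul_left _ h6

/-- If `m ≥ 3` is odd and `|ĝ| ≤ 2 ^ m`, then a function `g ≤ 1` in `2 * m` variables cannot
be `1` on all vectors of weight less than `(m + 5) / 2`. -/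
theorem not_eq_one_on_ball {m D : ℕ} (hm : 3 ≤ m) (hD : 2 * D = m + 5) {g : V (2 * m) → ℝ}
    (hC : ∀ w, |walsh g w| ≤ 2 ^ m) (hg : ∀ x, g x ≤ 1)
    (h1 : ∀ T : Finset (Fin (2 * m)), T.card < D → g (indicatorVec T) = 1) : False := by
  have hD' : 2 * (D : ℝ) = m + 5 := by exact_mod_cast hD
  have hpos : (0 : ℝ) < 2 ^ m := by positivity
  rcases lt_or_ge m 11 with hlt | hge
  -- Here the test yields `2 ^ (m + 4) ≤ (m + 5) * 2 ^ m`, which forces `m ≥ 11`.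
  · have h := linear_test hC hg h1 (k := m + 3) (by omega) (e := -2)
      (by push_cast; linarith)
    have hm' : (m : ℝ) < 11 := by exact_mod_cast hlt
    rw [pow_add] at h
    norm_num at h
    nlinarith
  · obtain ⟨e, c, he, h⟩ := exists_cubic_parameters hge
    -- As `2 * D = m + 5`, the dimension is `k = m + 5 + e`; the condition `e + 5 ≤ m` makes it fit
    -- into `2 * m` variables.
    have h2 := cubic_test hC hg h1 (k := m + 5 + e) (by omega) (e := e)
      (by push_cast; linarith) c
    rw [Nat.abs_cast, Nat.abs_cast] at h2
    have h' : ((m : ℝ) + 5 + e + e) * (m + 5 + e + c) ^ 2 + 2 ^ (e + 5) * (e * c ^ 2 +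
      e * (m + 5 + e)) < 2 ^ (e + 5) * (2 * c * (m + 5 + e)) := by exact_mod_cast h
    have h3 := mul_lt_mul_of_pos_left h' hpos
    push_cast at h2
    have h4 : (2 : ℝ) ^ (m + 5 + e) = 2 ^ m * 2 ^ (e + 5) := by
      rw [← pow_add]; congr 1; ring
    rw [h4] at h2
    linarith

/-! ### Application to homogeneous bent functions -/

lemma signFun_le_one {n : ℕ} (f : BoolFun n) (x : V n) : signFun f x ≤ 1 := by
  unfold signFun
  rcases neg_one_pow_eq_or ℝ (f x).val with h | h <;> rw [h]
  norm_num

lemma IsBent.abs_walsh_le {m : ℕ} {f : BoolFun (2 * m)} (hf : IsBent f) (w : V (2 * m)) :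
    |walsh (signFun f) w| ≤ 2 ^ m := by
  have h : (2 : ℝ) ^ (((2 * m : ℕ) : ℝ) / 2) = 2 ^ m := by
    rw [← Real.rpow_natCast]; congr 1; push_cast; ring
  have h2 : (0 : ℝ) ≤ 2 ^ m := by positivity
  rcases hf w with hw | hw <;> rw [hw, h]
  · rw [abs_of_nonneg h2]
  · rw [abs_neg, abs_of_nonneg h2]

lemma IsHomogeneous.card_eq_degree {n : ℕ} {f : BoolFun n} (hf : IsHomogeneous f)
    {S : Finset (Fin n)} (hS : anfCoeff f S ≠ 0) : S.card = degree f := by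
  obtain ⟨a, ha⟩ := Finset.card_eq_one.1 hf
  have h1 : S.card ∈ degreeSet f :=
    Finset.mem_image_of_mem _ (Finset.mem_filter.2 ⟨Finset.mem_univ S, hS⟩)
  rw [ha, Finset.mem_singleton] at h1
  simp [degree, ha, h1]

lemma IsHomogeneous.apply_eq_zero {n : ℕ} {f : BoolFun n} (hf : IsHomogeneous f)
    {T : Finset (Fin n)} (hT : T.card < degree f) : f (indicatorVec T) = 0 := by
  rw [anf_expansion f, sum_monomial]
  refine Finset.sum_eq_zero fun S hS => ?_
  by_contra h
  have := Finset.card_le_card (Finset.mem_powerset.1 hS)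
  have := hf.card_eq_degree h
  omega

end RotBent

theorem mainTheorem5 (p n d : ℕ) (hp : p.Prime) (hodd : Odd p) (hn : n = 2 * p)
    (f : RotBent.BoolFun n) (hhom : RotBent.IsHomogeneous f)
    (hrot : RotBent.IsRotationSymmetric f) (hbent : RotBent.IsBent f)
    (hdeg : RotBent.degree f = d) (hd : 3 ≤ d) :
    (d : ℝ) ≤ ((p : ℝ) + 3) / 2 := by
  subst hn
  by_contra hcon
  have hlt : p + 3 < 2 * d := by
    have : ((p : ℝ) + 3) < 2 * d := by linarith
    exact_mod_cast this
  obtain ⟨r, hr⟩ := hodd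
  have hp2 := hp.two_le
  -- With `p = 2 * r + 1`, the assumption `p + 3 < 2 * d` says `d ≥ r + 3 = (p + 5) / 2`.
  refine RotBent.not_eq_one_on_ball (m := p) (D := r + 3) (by omega) (by omega)
    hbent.abs_walsh_le (RotBent.signFun_le_one f) fun T hT => ?_
  rw [RotBent.signFun, hhom.apply_eq_zero (by omega)]
  simp
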